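/- Let $p\ge 1$. A word $a_1\cdots a_n$ over $\mathbb{N}=\{0,1,2,\dots\}$ is a $p$-ascent sequence if $a_1=0$ and $0\le a_i\le p+\mathrm{asc}(a_1\cdots a_{i-1})$ for $2\le i\le n$, where $\mathrm{asc}(a_1\cdots a_m)=|\{j: 1\le j<m,\ a_j<a_{j+1}\}|$. For $r\ge 1$ let $$G^{(p)}_r(t,u,v,z)=\sum_{w} t^{|w|}u^{\mathrm{asc}(w)}v^{\mathrm{last}(w)}z^{|w|_0},$$ where $w$ runs over the $p$-ascent sequences that begin with exactly $r$ zeros followed by a nonzero letter, $|w|$ is the length of $w$, $\mathrm{last}(w)$ its last letter and $|w|_0$ its number of zeros. For each value of $(|w|,\mathrm{asc}(w),\mathrm{last}(w),|w|_0)$ there are finitely many such $w$, so that $G^{(p)}_r\in\mathbb{Z}[[t,u,v,z]]$. Put $$\delta_k=u-(1-t)^k(u-1)\quad(k\ge 0),\qquad \gamma_k=u-(1-zt)(1-t)^{k-1}(u-1)\quad(k\ge 1),$$ so that $\delta_0=1$, and let $\bar\delta_k$, $\bar\gamma_k$ be obtained from $\delta_k$, $\gamma_k$ by replacing $u$ by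 $uv$. In the ring $\mathbb{Z}[[t,u,v,z]]$ of formal power series all the $\delta_k,\bar\delta_k,\gamma_k,\bar\gamma_k$ and $v\delta_1-1$ are invertible, the two infinite sums below converge coefficientwise (each coefficient receives only finitely many nonzero contributions), and for all $r\ge 1$ $$G^{(p)}_r(t,u,v,z)=t^rz^r\left(\frac{tuv(v^p-1)}{v\delta_1-1}+\frac{t(z(v-1)-v)}{v\delta_1-1}\sum_{k\ge1}\frac{u^k(\delta_{k-1}^p-\delta_k^p)}{\gamma_1\cdots\gamma_k\,\delta_{k-1}^p\delta_k^p}+\frac{tuv^{p+1}}{v\delta_1-1}\sum_{k\ge1}\frac{(uv)^k(\bar\delta_{k-1}^p-\bar\delta_k^p)}{\bar\gamma_1\cdots\bar\gamma_k\,\bar\delta_{k-1}^p\bar\delta_k^p}\right).$$ -/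

import Mathlib

open scoped MvPowerSeries.WithPiTopology

namespace PAscent

/-- The number of ascents of a word: the number of adjacent positions `a_j < a_{j+1}`. -/
def asc : List ℕ → ℕ
  | [] => 0
  | [_] => 0
  | a :: b :: w => (if a < b then 1 else 0) + asc (b :: w)

/-- A `p`-ascent sequence: the first letter is `0`, and every later letter is at most `p` plus the
number of ascents of the word formed by the letters before it.  The empty word is one. -/
def IsPAscent (p : ℕ) (w : List ℕ) : Prop :=
  (∀ h : 0 < w.length, w[0] = 0) ∧
    ∀ i, 1 ≤ i → ∀ h : i < w.length, w[i] ≤ p + asc (w.take i)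

/-- The word `w` begins with exactly `r` zeros, followed by a nonzero letter. -/
def InitialRun (r : ℕ) (w : List ℕ) : Prop :=
  ∃ c : ℕ, c ≠ 0 ∧ (List.replicate r 0 ++ [c]) <+: w

/-- The `p`-ascent sequences that begin with `r` zeros followed by a nonzero letter and have length
`n`, `a` ascents, last letter `l` and `m` zeros in total. -/
def seqs (p r n a l m : ℕ) : Set (List ℕ) :=
  {w | IsPAscent p w ∧ InitialRun r w ∧ w.length = n ∧ asc w = a ∧ w.getLast? = some l ∧
    w.count 0 = m}

/-- Formal power series over `ℤ` in the four commuting variables `t, u, v, z`.  Infinite sums are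
taken in the product topology over the discrete ring `ℤ`, that is, coefficient by coefficient. -/
abbrev Series : Type := MvPowerSeries (Fin 4) ℤ

noncomputable section

def t : Series := MvPowerSeries.X 0
def u : Series := MvPowerSeries.X 1
def v : Series := MvPowerSeries.X 2
def z : Series := MvPowerSeries.X 3

/-- The generating function whose coefficient of `t^n u^a v^l z^m` is the number of words in
`seqs p r n a l m`. -/
def G (p r : ℕ) : Series :=
  fun e => ((seqs p r (e 0) (e 1) (e 2) (e 3)).ncard : ℤ)

/-- `δ_k`, with a general argument `x` in place of `u`; at `k = 0` this is `1`. -/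
def delta (x : Series) (k : ℕ) : Series := x - (1 - t) ^ k * (x - 1)

/-- `γ_k` for `k ≥ 1`, with a general argument `x` in place of `u`. -/
def gamma (x : Series) (k : ℕ) : Series := x - (1 - z * t) * (1 - t) ^ (k - 1) * (x - 1)

/-- `x^k (δ_{k-1}^p - δ_k^p) / (γ_1 ⋯ γ_k δ_{k-1}^p δ_k^p)` for `k ≥ 1`, where `δ` and `γ` have
argument `x`; `Ring.inverse` is the inverse on units. -/
def term (p : ℕ) (x : Series) (k : ℕ) : Series :=
  x ^ k * (delta x (k - 1) ^ p - delta x k ^ p) *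
    Ring.inverse ((∏ i ∈ Finset.Icc 1 k, gamma x i) * delta x (k - 1) ^ p * delta x k ^ p)

end

end PAscent

namespace PAscent

/-! The proof is the kernel method. Appending a letter `c ≤ p + asc w` to a word and summing over
`c` gives a linear equation (`one_sub_mul_delta_one_mul_genFun`) that expresses F(x, y) = `genFun p
r x y` through F(x, 1) and F(xy, 1). At y = 1/δ_1 the coefficient of F(x, y) vanishes, which links
F(x, 1) to F(x/δ_1, 1). Since x/δ_k is sent to x/δ_{k+1}, the link iterates; each step gains a
factor x, so the remainder tends to 0 and F(x, 1) is the stated series (`genFun_one_eq_tsum`).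
Taking this at x = u and x = uv in the equation for F(u, v) gives the formula. Letting x and y be
arbitrary series makes every substitution a mere instantiation. -/

/-! ### Words built by appending letters. -/

theorem asc_concat (w : List ℕ) (hw : w ≠ []) (c : ℕ) :
    asc (w ++ [c]) = asc w + if w.getLastD 0 < c then 1 else 0 := by
  induction w with
  | nil => exact absurd rfl hw
  | cons a w ih =>
    cases w with
    | nil => simp [asc]
    | cons b w =>
      have h := ih (by simp)
      simp only [List.cons_append, asc] at h ⊢
      rw [h, add_assoc]
      simp

theorem asc_replicate_zero (r : ℕ) : asc (List.replicate r 0) = 0 := by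
  induction r with
  | zero => rfl
  | succ r ih =>
    cases r with
    | zero => rfl
    | succ r => simpa [List.replicate_succ, asc] using ih

theorem isPAscent_concat {p : ℕ} {w : List ℕ} (hw : w ≠ []) (c : ℕ) :
    IsPAscent p (w ++ [c]) ↔ IsPAscent p w ∧ c ≤ p + asc w := by
  have hl : 0 < w.length := List.length_pos_iff.mpr hw
  constructor
  · rintro ⟨h0, h⟩
    refine ⟨⟨fun _ => ?_, fun i hi hil => ?_⟩, ?_⟩
    · simpa [List.getElem_append_left hl] using h0 (by simp)
    · have := h i hi (by simp; omega)
      rwa [List.getElem_append_left hil, List.take_append_of_le_length hil.le] at this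
    · simpa using h w.length hl (by simp)
  · rintro ⟨⟨h0, h⟩, hc⟩
    refine ⟨fun _ => ?_, fun i hi hil => ?_⟩
    · simpa [List.getElem_append_left hl] using h0 hl
    · rcases lt_or_ge i w.length with hiw | hiw
      · rw [List.getElem_append_left hiw, List.take_append_of_le_length hiw.le]
        exact h i hi hiw
      · obtain rfl : i = w.length := by simp at hil; omega
        simpa using hc

theorem isPAscent_replicate_zero (p r : ℕ) : IsPAscent p (List.replicate r 0) :=
  ⟨fun _ => by simp, fun i _ _ => by simp⟩

theorem InitialRun.lt_length {r : ℕ} {w : List ℕ} (h : InitialRun r w) : r < w.length := by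
  obtain ⟨c, -, hp⟩ := h
  simpa using hp.length_le

theorem initialRun_concat {r : ℕ} {w : List ℕ} (hw : r < w.length) (c : ℕ) :
    InitialRun r (w ++ [c]) ↔ InitialRun r w := by
  refine exists_congr fun d => and_congr_right fun _ => ?_
  rw [List.prefix_concat_iff, or_iff_right]
  intro h
  have := congrArg List.length h
  simp at this
  omega

/-- The `p`-ascent sequences of length `r + k + 1` that begin with exactly `r` zeros followed by
a nonzero letter, built by appending letters. -/
def words (p r : ℕ) : ℕ → Finset (List ℕ)
  | 0 => (Finset.Icc 1 p).image fun c => List.replicate r 0 ++ [c]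
  | k + 1 => ((words p r k).sigma fun w => Finset.range (p + asc w + 1)).image
      fun x => x.1 ++ [x.2]

theorem mem_words {p r : ℕ} (hr : 1 ≤ r) {k : ℕ} {w : List ℕ} :
    w ∈ words p r k ↔ IsPAscent p w ∧ InitialRun r w ∧ w.length = r + k + 1 := by
  induction k generalizing w with
  | zero =>
    have hne : List.replicate r 0 ≠ [] := by simp; omega
    simp only [words, Finset.mem_image, Finset.mem_Icc]
    constructor
    · rintro ⟨c, ⟨h1, h2⟩, rfl⟩
      refine ⟨(isPAscent_concat hne c).2 ⟨isPAscent_replicate_zero p r, ?_⟩,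
        ⟨c, by omega, List.prefix_rfl⟩, by simp⟩
      rwa [asc_replicate_zero]
    · rintro ⟨h1, ⟨c, hc, hp⟩, hl⟩
      obtain rfl := hp.eq_of_length (by simp [hl])
      have := ((isPAscent_concat hne c).1 h1).2
      rw [asc_replicate_zero] at this
      exact ⟨c, ⟨by omega, this⟩, rfl⟩
  | succ k ih =>
    simp only [words, Finset.mem_image, Finset.mem_sigma, Finset.mem_range, Sigma.exists]
    constructor
    · rintro ⟨w, c, ⟨hw, hc⟩, rfl⟩
      obtain ⟨h1, h2, h3⟩ := ih.1 hw
      have hne : w ≠ [] := by rintro rfl; simp at h3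
      exact ⟨(isPAscent_concat hne c).2 ⟨h1, by omega⟩,
        (initialRun_concat h2.lt_length c).2 h2, by simp; omega⟩
    · rintro ⟨h1, h2, h3⟩
      obtain rfl | ⟨w, c, rfl⟩ := List.eq_nil_or_concat w
      · simp at h3
      · simp only [List.concat_eq_append, List.length_append, List.length_singleton] at *
        have hne : w ≠ [] := by rintro rfl; simp at h3
        have hi := (isPAscent_concat hne c).1 h1
        refine ⟨w, c, ⟨ih.2 ⟨hi.1, (initialRun_concat (by omega) c).1 h2, by omega⟩, ?_⟩, rfl⟩
        omega

theorem ne_nil_of_mem_words {p r k : ℕ} (hr : 1 ≤ r) {w : List ℕ} (hw : w ∈ words p r k) :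
    w ≠ [] := by
  rintro rfl
  simpa using ((mem_words hr).1 hw).2.2

/-- Ensures that the range of admissible next letters reaches past the last letter, so the sum over
them splits there. -/
theorem getLastD_le_of_mem_words {p r k : ℕ} (hr : 1 ≤ r) {w : List ℕ} (hw : w ∈ words p r k) :
    w.getLastD 0 ≤ p + asc w := by
  obtain ⟨h1, h2, h3⟩ := (mem_words hr).1 hw
  obtain rfl | ⟨w, c, rfl⟩ := List.eq_nil_or_concat w
  · simp
  · simp only [List.concat_eq_append, List.length_append, List.length_singleton] at *
    have hne : w ≠ [] := by rintro rfl; simp at h3; omega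
    have := ((isPAscent_concat hne c).1 h1).2
    rw [asc_concat w hne, List.getLastD_concat]
    omega

theorem seqs_eq_filter {p r n a l m k : ℕ} (hr : 1 ≤ r) (hn : n = r + k + 1) :
    seqs p r n a l m =
      ↑((words p r k).filter fun w => asc w = a ∧ w.getLastD 0 = l ∧ w.count 0 = m) := by
  ext w
  simp only [seqs, Set.mem_ofPred_eq, Finset.coe_filter, mem_words hr, ← hn]
  rcases eq_or_ne w [] with rfl | hw
  · simp [hn]
  · rw [List.getLastD_eq_getLast?, List.getLast?_eq_some_getLast hw]
    simp only [Option.some.injEq, Option.getD_some]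
    tauto

theorem seqs_eq_empty {p r n a l m : ℕ} (hn : n ≤ r) : seqs p r n a l m = ∅ := by
  ext w
  simp only [seqs, Set.mem_ofPred_eq, Set.mem_empty_iff_false, iff_false]
  rintro ⟨-, h, hl, -⟩
  have := h.lt_length
  omega

theorem finite_seqs {p r : ℕ} (hr : 1 ≤ r) (n a l m : ℕ) : (seqs p r n a l m).Finite := by
  rcases le_or_gt n r with hn | hn
  · rw [seqs_eq_empty hn]
    exact Set.finite_empty
  · rw [seqs_eq_filter (k := n - r - 1) hr (by omega)]
    exact Finset.finite_toSet _

theorem sum_words_succ {M : Type*} [AddCommMonoid M] (p r k : ℕ) (f : List ℕ → M) :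
    ∑ w ∈ words p r (k + 1), f w =
      ∑ w ∈ words p r k, ∑ c ∈ Finset.range (p + asc w + 1), f (w ++ [c]) := by
  rw [words, Finset.sum_image, Finset.sum_sigma]
  rintro ⟨w, c⟩ - ⟨w', c'⟩ - h
  obtain ⟨rfl, h⟩ := List.append_inj' h rfl
  simpa using h

theorem sum_words_zero {M : Type*} [AddCommMonoid M] (p r : ℕ) (f : List ℕ → M) :
    ∑ w ∈ words p r 0, f w = ∑ c ∈ Finset.Icc 1 p, f (List.replicate r 0 ++ [c]) := by
  rw [words, Finset.sum_image]
  exact fun _ _ _ _ h => by simpa using h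

/-! ### The functional equation. -/

noncomputable section

/-- The weight `x^asc(w) y^last(w) z^|w|_0` of a word, for series `x` and `y`. -/
def weight (x y : Series) (w : List ℕ) : Series :=
  x ^ asc w * y ^ w.getLastD 0 * z ^ w.count 0

/-- Two geometric sums, split at the last letter `l`: only letters above `l` create an ascent, and
`c` marks the letter 0. The factor `1 - y` replaces a division, so `y = 1` is allowed. -/
theorem one_sub_mul_sum_range_letters {R : Type*} [CommRing R] (x y c : R) {l N : ℕ} (h : l < N) :
    (1 - y) * ∑ i ∈ Finset.range N, (if l < i then x else 1) * y ^ i * (if i = 0 then c else 1) =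
      (1 - y) * (c - 1) + (1 - y ^ (l + 1)) + x * (y ^ (l + 1) - y ^ N) := by
  induction N, h using Nat.le_induction with
  | base =>
    have : ∀ i ∈ Finset.range (l + 1),
        (if l < i then x else 1) * y ^ i * (if i = 0 then c else 1) =
          y ^ i + if i = 0 then c - 1 else 0 := by
      intro i hi
      rw [Finset.mem_range] at hi
      rw [if_neg (by omega)]
      split_ifs with h0
      · subst h0; ring
      · ring
    rw [Nat.succ_eq_add_one, Finset.sum_congr rfl this, Finset.sum_add_distrib, mul_add,
      mul_neg_geom_sum, Finset.sum_ite_eq' _ 0, if_pos (by simp)]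
    ring
  | succ n hn ih =>
    rw [Finset.sum_range_succ, mul_add, ih, if_pos (by omega), if_neg (by omega)]
    ring

theorem weight_concat (x y : Series) {w : List ℕ} (hw : w ≠ []) (c : ℕ) :
    weight x y (w ++ [c]) = x ^ asc w * z ^ w.count 0 *
      ((if w.getLastD 0 < c then x else 1) * y ^ c * (if c = 0 then z else 1)) := by
  simp only [weight, asc_concat w hw, List.getLastD_concat, List.count_append, pow_add,
    List.count_singleton, beq_iff_eq]
  split_ifs <;> ring

/-- The part of the generating function that is contributed by `words p r k`, without the factor
`t^(r + k + 1)`. -/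
def wordSum (p r : ℕ) (x y : Series) (k : ℕ) : Series :=
  ∑ w ∈ words p r k, weight x y w

theorem wordSum_succ {p r : ℕ} (hr : 1 ≤ r) (x y : Series) (k : ℕ) :
    (1 - y) * wordSum p r x y (k + 1) =
      (z * (1 - y) + y) * wordSum p r x 1 k + (x - 1) * y * wordSum p r x y k -
        x * y ^ (p + 1) * wordSum p r (x * y) 1 k := by
  simp only [wordSum, sum_words_succ, Finset.mul_sum]
  rw [← Finset.sum_add_distrib, ← Finset.sum_sub_distrib]
  refine Finset.sum_congr rfl fun w hw => ?_
  rw [← Finset.mul_sum, Finset.sum_congr rfl fun c _ =>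
    weight_concat x y (ne_nil_of_mem_words hr hw) c, ← Finset.mul_sum, mul_left_comm,
    one_sub_mul_sum_range_letters x y z (Nat.lt_succ_of_le (getLastD_le_of_mem_words hr hw))]
  simp only [weight, one_pow, mul_one, mul_pow, Nat.succ_eq_add_one]
  ring

theorem wordSum_zero {p r : ℕ} (hr : 1 ≤ r) (x y : Series) :
    (1 - y) * wordSum p r x y 0 = z ^ r * (x * y * (1 - y ^ p)) := by
  have hne : List.replicate r 0 ≠ [] := by simp; omega
  have hlast : (List.replicate r 0).getLastD 0 = 0 := by
    obtain ⟨s, rfl⟩ := Nat.exists_eq_add_of_le' hr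
    simp [List.replicate_succ']
  have : ∀ c ∈ Finset.Icc 1 p, weight x y (List.replicate r 0 ++ [c]) = z ^ r * x * y ^ c := by
    intro c hc
    rw [Finset.mem_Icc] at hc
    rw [weight_concat x y hne, asc_replicate_zero, hlast, if_pos (by omega), if_neg (by omega)]
    simp
    ring
  rw [wordSum, sum_words_zero, Finset.sum_congr rfl this, ← Finset.mul_sum]
  have h : (1 - y) * ∑ c ∈ Finset.Icc 1 p, y ^ c = y * (1 - y ^ p) := by
    rw [← Finset.Ico_add_one_right_eq_Icc, Finset.sum_Ico_eq_sum_range]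
    simp only [pow_add, pow_one, Nat.add_sub_cancel]
    rw [← Finset.mul_sum, mul_left_comm, mul_neg_geom_sum]
  linear_combination z ^ r * x * h

/-- The order of the `k`-th term is at least `k`, whatever `g` is. -/
theorem summable_pow_mul {a : Series} (ha : MvPowerSeries.constantCoeff a = 0) (g : ℕ → Series) :
    Summable fun k => a ^ k * g k := by
  refine MvPowerSeries.WithPiTopology.summable_of_tendsto_order_atTop_nhds_top
    (ENat.tendsto_nhds_top_iff_natCast_lt.mpr fun n => ?_)
  filter_upwards [Filter.eventually_gt_atTop n] with k hk
  have h := MvPowerSeries.le_order_pow_of_constantCoeff_eq_zero k ha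
  calc (n : ℕ∞) < k := by exact_mod_cast hk
    _ ≤ (a ^ k).order := h
    _ ≤ (a ^ k).order + (g k).order := le_self_add
    _ ≤ _ := MvPowerSeries.le_order_mul

theorem constantCoeff_t : MvPowerSeries.constantCoeff t = 0 := MvPowerSeries.constantCoeff_X 0
theorem constantCoeff_u : MvPowerSeries.constantCoeff u = 0 := MvPowerSeries.constantCoeff_X 1
theorem constantCoeff_v : MvPowerSeries.constantCoeff v = 0 := MvPowerSeries.constantCoeff_X 2

/-- The generating function of the `p`-ascent sequences that begin with exactly `r` zeros followed
by a nonzero letter, with series `x` and `y` marking the ascents and the last letter. -/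
def genFun (p r : ℕ) (x y : Series) : Series :=
  ∑' k, t ^ (r + k + 1) * wordSum p r x y k

theorem hasSum_genFun (p r : ℕ) (x y : Series) :
    HasSum (fun k => t ^ (r + k + 1) * wordSum p r x y k) (genFun p r x y) := by
  have := (summable_pow_mul constantCoeff_t (wordSum p r x y)).mul_left (t ^ (r + 1))
  refine (this.congr fun k => ?_).hasSum
  ring

theorem one_sub_mul_delta_one_mul_genFun {p r : ℕ} (hr : 1 ≤ r) (x y : Series) :
    (1 - y * delta x 1) * genFun p r x y =
      t ^ r * z ^ r * (t * x * y * (1 - y ^ p)) +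
        t * (z * (1 - y) + y) * genFun p r x 1 -
        t * x * y ^ (p + 1) * genFun p r (x * y) 1 := by
  have h := ((((hasSum_genFun p r x 1).mul_left (t * (z * (1 - y) + y))).add
    ((hasSum_genFun p r x y).mul_left (t * ((x - 1) * y)))).sub
    ((hasSum_genFun p r (x * y) 1).mul_left (t * (x * y ^ (p + 1))))).congr_fun (g := fun k =>
      (1 - y) * (t ^ (r + (k + 1) + 1) * wordSum p r x y (k + 1))) fun k => by
        linear_combination t ^ (r + k + 2) * wordSum_succ (p := p) hr x y k
  -- Two evaluations of the series without its `k = 0` term; that term is the inhomogeneous part.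
  have h' := (hasSum_nat_add_iff' 1).2 ((hasSum_genFun p r x y).mul_left (1 - y))
  have e := h'.unique h
  rw [Finset.sum_range_one] at e
  simp only [delta]
  linear_combination e + t ^ (r + 1) * wordSum_zero hr x y

/-! ### Coefficients: `G` is `genFun` at `u`, `v`. -/

theorem weight_eq_monomial (w : List ℕ) (n : ℕ) : t ^ n * weight u v w =
    MvPowerSeries.monomial (Finsupp.equivFunOnFinite.symm
      ![n, asc w, w.getLastD 0, w.count 0]) (1 : ℤ) := by
  simp only [weight, t, u, v, z, MvPowerSeries.X_pow_eq, MvPowerSeries.monomial_mul_monomial,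
    mul_one]
  congr 2
  ext i
  fin_cases i <;> simp

theorem coeff_pow_mul_weight (w : List ℕ) (n : ℕ) (e : Fin 4 →₀ ℕ) :
    MvPowerSeries.coeff e (t ^ n * weight u v w) =
      if n = e 0 ∧ asc w = e 1 ∧ w.getLastD 0 = e 2 ∧ w.count 0 = e 3 then 1 else 0 := by
  rw [weight_eq_monomial, MvPowerSeries.coeff_monomial]
  refine if_congr ?_ rfl rfl
  rw [eq_comm, Equiv.symm_apply_eq, funext_iff, Fin.forall_fin_succ, Fin.forall_fin_succ,
    Fin.forall_fin_succ, Fin.forall_fin_one]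
  rfl

theorem coeff_pow_mul_wordSum (p r k : ℕ) (e : Fin 4 →₀ ℕ) :
    MvPowerSeries.coeff e (t ^ (r + k + 1) * wordSum p r u v k) =
      if r + k + 1 = e 0 then (((words p r k).filter fun w =>
        asc w = e 1 ∧ w.getLastD 0 = e 2 ∧ w.count 0 = e 3).card : ℤ) else 0 := by
  simp only [wordSum, Finset.mul_sum, map_sum, coeff_pow_mul_weight]
  split_ifs with h
  · simp only [h, true_and, Finset.sum_boole]
  · simp [h]

theorem G_eq_genFun {p r : ℕ} (hr : 1 ≤ r) : G p r = genFun p r u v := by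
  refine HasSum.unique (MvPowerSeries.WithPiTopology.hasSum_iff_hasSum_coeff.2 fun e => ?_)
    (hasSum_genFun p r u v)
  simp only [coeff_pow_mul_wordSum]
  change HasSum _ ((seqs p r (e 0) (e 1) (e 2) (e 3)).ncard : ℤ)
  rcases le_or_gt (e 0) r with hn | hn
  · rw [seqs_eq_empty hn, Set.ncard_empty]
    convert! hasSum_zero with k
    exact if_neg (by omega)
  · have hk : e 0 = r + (e 0 - r - 1) + 1 := by omega
    rw [seqs_eq_filter hr hk, Set.ncard_coe_finset]
    convert! hasSum_single (e 0 - r - 1) fun k hk => ?_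
    · rw [if_pos hk.symm]
    · exact if_neg (by omega)

/-! ### Invertibility and the kernel method. -/

theorem isUnit_of_constantCoeff_eq_one {a : Series} (h : MvPowerSeries.constantCoeff a = 1) :
    IsUnit a := by
  rw [MvPowerSeries.isUnit_iff_constantCoeff, h]
  exact isUnit_one

theorem isUnit_delta {x : Series} (hx : MvPowerSeries.constantCoeff x = 0) (k : ℕ) :
    IsUnit (delta x k) :=
  isUnit_of_constantCoeff_eq_one (by simp [delta, hx, constantCoeff_t])

theorem isUnit_gamma {x : Series} (hx : MvPowerSeries.constantCoeff x = 0) (k : ℕ) :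
    IsUnit (gamma x k) :=
  isUnit_of_constantCoeff_eq_one (by simp [gamma, hx, constantCoeff_t])

theorem isUnit_v_mul_delta_one_sub_one : IsUnit (v * delta u 1 - 1) := by
  rw [MvPowerSeries.isUnit_iff_constantCoeff]
  simp [constantCoeff_v]

/-- The kernel equation: the functional equation at `y = 1 / δ_1`. -/
theorem gamma_one_mul_genFun {p r : ℕ} (hr : 1 ≤ r) (x y : Series) (hy : y * delta x 1 = 1) :
    gamma x 1 * genFun p r x 1 =
      x * (t ^ r * z ^ r * (y ^ p - 1) + y ^ p * genFun p r (x * y) 1) := by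
  have h := one_sub_mul_delta_one_mul_genFun (p := p) hr x y
  have ht : t ≠ 0 := fun h0 => by
    have := MvPowerSeries.coeff_index_single_self_X (R := ℤ) (0 : Fin 4)
    rw [← t, h0] at this
    simp at this
  have hy0 : y ≠ 0 := left_ne_zero_of_mul_eq_one hy
  refine mul_left_cancel₀ (mul_ne_zero ht hy0) ?_
  simp only [delta, gamma] at *
  linear_combination -h + (t * z * genFun p r x 1 - genFun p r x y) * hy

/-- The kernel equation at `x / δ_k`. -/
theorem gamma_succ_mul_genFun {p r : ℕ} (hr : 1 ≤ r) (x : Series) (k : ℕ) {a b : Series}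
    (ha : delta x k * a = 1) (hb : delta x (k + 1) * b = 1) :
    gamma x (k + 1) * genFun p r (x * a) 1 =
      x * (t ^ r * z ^ r * (delta x k ^ p * b ^ p - 1) +
        delta x k ^ p * b ^ p * genFun p r (x * b) 1) := by
  -- Both identities come from x/δ_k - 1 = (1-t)^k (x-1)/δ_k.
  have hd : delta (x * a) 1 = a * delta x (k + 1) := by
    simp only [delta] at *
    linear_combination (-(1 - t)) * ha
  have hg : gamma (x * a) 1 = a * gamma x (k + 1) := by
    simp only [delta, gamma, Nat.add_sub_cancel, Nat.sub_self] at *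
    linear_combination (-(1 - z * t)) * ha
  have h := gamma_one_mul_genFun (p := p) hr (x * a) (delta x k * b) (by
    rw [hd]; linear_combination delta x (k + 1) * b * ha + hb)
  rw [hg, show x * a * (delta x k * b) = x * b by linear_combination x * b * ha, mul_pow] at h
  linear_combination delta x k * h - (gamma x (k + 1) * genFun p r (x * a) 1 -
      x * (t ^ r * z ^ r * (delta x k ^ p * b ^ p - 1) +
        delta x k ^ p * b ^ p * genFun p r (x * b) 1)) * ha

theorem summable_term (p : ℕ) {x : Series} (hx : MvPowerSeries.constantCoeff x = 0) :
    Summable fun k => term p x (k + 1) := by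
  refine (summable_pow_mul hx fun k => x * (delta x k ^ p - delta x (k + 1) ^ p) *
    Ring.inverse ((∏ i ∈ Finset.Icc 1 (k + 1), gamma x i) * delta x k ^ p *
      delta x (k + 1) ^ p)).congr fun k => ?_
  simp only [term, Nat.add_sub_cancel]
  ring

/-- The remainder after `k` steps of the iteration of the kernel equation. -/
def remainder (p r : ℕ) (x : Series) (k : ℕ) : Series :=
  x ^ k * (Ring.inverse ((∏ i ∈ Finset.Icc 1 k, gamma x i) * delta x k ^ p) *
    genFun p r (x * Ring.inverse (delta x k)) 1)

/-- The kernel equation at x/δ_k, multiplied by x^k / (γ_1⋯γ_{k+1} δ_k^p). -/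
theorem remainder_eq (p : ℕ) {r : ℕ} (hr : 1 ≤ r) {x : Series}
    (hx : MvPowerSeries.constantCoeff x = 0) (k : ℕ) :
    remainder p r x k = t ^ r * z ^ r * term p x (k + 1) + remainder p r x (k + 1) := by
  have ha := Ring.mul_inverse_cancel _ (isUnit_delta hx k)
  have hb := Ring.mul_inverse_cancel _ (isUnit_delta hx (k + 1))
  have hc := Ring.mul_inverse_cancel _ (isUnit_gamma hx (k + 1))
  have h := gamma_succ_mul_genFun (p := p) hr x k ha hb
  have ha' : delta x k ^ p * Ring.inverse (delta x k) ^ p = 1 := by rw [← mul_pow, ha, one_pow]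
  have hb' : delta x (k + 1) ^ p * Ring.inverse (delta x (k + 1)) ^ p = 1 := by
    rw [← mul_pow, hb, one_pow]
  simp only [remainder, term, Nat.add_sub_cancel, Finset.prod_Icc_succ_top (Nat.le_add_left 1 k),
    Ring.mul_inverse_rev, ← Ring.inverse_pow] at *
  generalize genFun p r (x * Ring.inverse (delta x k)) 1 = g at *
  generalize genFun p r (x * Ring.inverse (delta x (k + 1))) 1 = g' at *
  generalize Ring.inverse (delta x k) ^ p = a at *
  generalize Ring.inverse (delta x (k + 1)) ^ p = b at *
  generalize Ring.inverse (gamma x (k + 1)) = c at *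
  generalize Ring.inverse (∏ i ∈ Finset.Icc 1 k, gamma x i) = q at *
  generalize delta x k ^ p = A at *
  generalize delta x (k + 1) ^ p = B at *
  linear_combination x ^ k * q * a * c * h - x ^ k * q * a * g * hc +
    x ^ (k + 1) * q * c * (a * t ^ r * z ^ r * hb' + b * g' * ha')

theorem genFun_one_eq_tsum (p : ℕ) {r : ℕ} (hr : 1 ≤ r) {x : Series}
    (hx : MvPowerSeries.constantCoeff x = 0) :
    genFun p r x 1 = t ^ r * z ^ r * ∑' k, term p x (k + 1) := by
  have hs := (summable_term p hx).hasSum.mul_left (t ^ r * z ^ r)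
  have h0 : Filter.Tendsto (remainder p r x) Filter.atTop (nhds 0) :=
    (summable_pow_mul hx _).tendsto_atTop_zero
  -- The partial sums telescope, and `remainder p r x 0` is F(x, 1) because δ_0 = 1.
  have hsum : ∀ n, ∑ k ∈ Finset.range n, t ^ r * z ^ r * term p x (k + 1) =
      remainder p r x 0 - remainder p r x n := fun n => by
    rw [← Finset.sum_range_sub']
    exact Finset.sum_congr rfl fun k _ => by rw [remainder_eq p hr hx k]; ring
  have hlim := (tendsto_const_nhds (x := remainder p r x 0)).sub h0
  have := tendsto_nhds_unique ((hs.tendsto_sum_nat).congr hsum) hlim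
  rw [this]
  simp [remainder, delta]

end

end PAscent

theorem mainTheorem3 (p r : ℕ) (hp : 1 ≤ p) (hr : 1 ≤ r) :
    (∀ n a l m : ℕ, (PAscent.seqs p r n a l m).Finite) ∧
    (∀ k : ℕ, IsUnit (PAscent.delta PAscent.u k) ∧
      IsUnit (PAscent.delta (PAscent.u * PAscent.v) k)) ∧
    (∀ k : ℕ, 1 ≤ k → IsUnit (PAscent.gamma PAscent.u k) ∧
      IsUnit (PAscent.gamma (PAscent.u * PAscent.v) k)) ∧
    IsUnit (PAscent.v * PAscent.delta PAscent.u 1 - 1) ∧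
    Summable (fun k : ℕ => PAscent.term p PAscent.u (k + 1)) ∧
    Summable (fun k : ℕ => PAscent.term p (PAscent.u * PAscent.v) (k + 1)) ∧
    PAscent.G p r =
      PAscent.t ^ r * PAscent.z ^ r *
        (PAscent.t * PAscent.u * PAscent.v * (PAscent.v ^ p - 1) *
            Ring.inverse (PAscent.v * PAscent.delta PAscent.u 1 - 1) +
          PAscent.t * (PAscent.z * (PAscent.v - 1) - PAscent.v) *
            Ring.inverse (PAscent.v * PAscent.delta PAscent.u 1 - 1) *
            ∑' k : ℕ, PAscent.term p PAscent.u (k + 1) +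
          PAscent.t * PAscent.u * PAscent.v ^ (p + 1) *
            Ring.inverse (PAscent.v * PAscent.delta PAscent.u 1 - 1) *
            ∑' k : ℕ, PAscent.term p (PAscent.u * PAscent.v) (k + 1)) := by
  have huv : MvPowerSeries.constantCoeff (PAscent.u * PAscent.v) = 0 := by
    simp [PAscent.constantCoeff_u]
  refine ⟨PAscent.finite_seqs hr,
    fun k => ⟨PAscent.isUnit_delta PAscent.constantCoeff_u k, PAscent.isUnit_delta huv k⟩,
    fun k _ => ⟨PAscent.isUnit_gamma PAscent.constantCoeff_u k, PAscent.isUnit_gamma huv k⟩,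
    PAscent.isUnit_v_mul_delta_one_sub_one, PAscent.summable_term p PAscent.constantCoeff_u,
    PAscent.summable_term p huv, ?_⟩
  have h := PAscent.one_sub_mul_delta_one_mul_genFun (p := p) hr PAscent.u PAscent.v
  rw [PAscent.genFun_one_eq_tsum p hr PAscent.constantCoeff_u,
    PAscent.genFun_one_eq_tsum p hr huv, ← PAscent.G_eq_genFun hr] at h
  have hi := Ring.mul_inverse_cancel _ PAscent.isUnit_v_mul_delta_one_sub_one
  linear_combination (-Ring.inverse (PAscent.v * PAscent.delta PAscent.u 1 - 1)) * h -
    PAscent.G p r * hi
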